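/- **Lemma (Dimension formula for moving bodies).** Let $d\ge 1$ and $k,n,m,f,h,g\ge 0$ be integers. Let $M$ (individual camera parameters), $B$ (global camera parameters) and $S$ (retinal surface) be real analytic manifolds of dimensions $f$, $h$ and $d-1$. For $(q,b)\in M\times B$ let $Q_{q,b}:\mathbb R^d\to\mathbb R^d$ be a camera, that is, a map with $Q_{q,b}\circ Q_{q,b}=Q_{q,b}$ whose image is an embedded hypersurface, identified with $S$ by a diffeomorphism; write $\pi_{q,b}(x)\in S$ for the point of $S$ that corresponds to $Q_{q,b}(x)$. A moving point is a Taylor polynomial of order $k$, $$P(t)=\sum_{l=0}^{k}t^l p_l,\qquad p_0,\dots,p_k\in\mathbb R^d,$$ so that the manifold $N=(\mathbb R^d)^{k+1}$ of moving points has dimension $d(k+1)$. Fix times $t_1,\dots,t_m\in\mathbb R$. On the configuration space $X=N^n\times M^m\times B$ consider the structure from motion map $$F:X\to S^{nm},\qquad F(P_1,\dots,P_n,q_1,\dots,q_m,b)=\bigl(\pi_{q_j,b}(P_i(t_j))\bigr)_{1\le i\le n,\ 1\le j\le m},$$ and let $W\subseteq X$ be an open set on which $F$ is real analytic. Let $G$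 be a (second countable) Lie group of dimension $g$ that acts smoothly on $X$ without changing the pictures: $F(\gamma x)=F(x)$ whenever $\gamma\in G$ and $x,\gamma x\in W$. Call $x\in W$ *locally reconstructible up to symmetry* if $x$ has a neighbourhood $U$ such that every $y\in U$ with $F(y)=F(x)$ lies in the orbit $Gx$. If the set of those $x\in W$ that are locally reconstructible up to symmetry does not have measure zero (in charts of $X$), then $$d\,n\,(k+1)+m f+h\;\le\; n\,m\,(d-1)+g .$$ Equivalently: if this inequality fails, then the simultaneous reconstruction of the point motions and of the cameras is impossible for almost every configuration in $W$. -/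

import Mathlib

open scoped Manifold ContDiff

noncomputable section

namespace StructureFromMotion

/-- The Taylor coefficients `p 0, …, p k` of the motion of a single point in `ℝ^d`. -/
abbrev PointMotion (d k : ℕ) : Type :=
  Fin (k + 1) → EuclideanSpace ℝ (Fin d)

/-- The position `P(t) = ∑_{l = 0}^{k} t^l p_l` of a moving point at time `t`. -/
def position {d k : ℕ} (p : PointMotion d k) (t : ℝ) : EuclideanSpace ℝ (Fin d) :=
  ∑ l : Fin (k + 1), t ^ (l : ℕ) • p l

/-- The point manifold has dimension `d (k + 1)`. -/
theorem finrank_pointMotion (d k : ℕ) :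
    Module.finrank ℝ (PointMotion d k) = d * (k + 1) := by
  simp [Module.finrank_pi_fintype, mul_comm]

/-- A camera type in `ℝ^d`: to individual parameters `q : M` and global parameters `b : B`
belongs an idempotent map `proj q b` of `ℝ^d` (the camera `Q`, with `Q ∘ Q = Q`), whose image (the
retinal surface) is an embedded hypersurface, diffeomorphic to the fixed `(d - 1)`-dimensional
manifold `S` through `retina q b`.  No regularity is demanded of `proj q b` itself, so that every
notion of piecewise smooth map is covered. -/
structure CameraType (d : ℕ) (M B S : Type*) [TopologicalSpace S]
    [ChartedSpace (EuclideanSpace ℝ (Fin (d - 1))) S] where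
  proj : M → B → EuclideanSpace ℝ (Fin d) → EuclideanSpace ℝ (Fin d)
  proj_proj : ∀ q b x, proj q b (proj q b x) = proj q b x
  retina : M → B → S → EuclideanSpace ℝ (Fin d)
  isSmoothEmbedding_retina : ∀ q b,
    Manifold.IsSmoothEmbedding (𝓡 (d - 1)) (𝓡 d) ∞ (retina q b)
  range_retina : ∀ q b, Set.range (retina q b) = Set.range (proj q b)

namespace CameraType

variable {d : ℕ} {M B S : Type*} [TopologicalSpace S]
  [ChartedSpace (EuclideanSpace ℝ (Fin (d - 1))) S]

theorem exists_retina_eq (C : CameraType d M B S) (q : M) (b : B)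
    (x : EuclideanSpace ℝ (Fin d)) : ∃ s : S, C.retina q b s = C.proj q b x := by
  have h : C.proj q b x ∈ Set.range (C.retina q b) := by
    rw [C.range_retina]
    exact ⟨x, rfl⟩
  exact h

/-- The picture of the scene point `x`: the image point `Q x`, read as a point of `S`. -/
def picture (C : CameraType d M B S) (q : M) (b : B) (x : EuclideanSpace ℝ (Fin d)) : S :=
  (C.exists_retina_eq q b x).choose

theorem retina_picture (C : CameraType d M B S) (q : M) (b : B)
    (x : EuclideanSpace ℝ (Fin d)) : C.retina q b (C.picture q b x) = C.proj q b x :=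
  (C.exists_retina_eq q b x).choose_spec

theorem picture_eq_iff (C : CameraType d M B S) (q : M) (b : B)
    (x : EuclideanSpace ℝ (Fin d)) (s : S) :
    C.picture q b x = s ↔ C.retina q b s = C.proj q b x := by
  rw [← C.retina_picture q b x, (C.isSmoothEmbedding_retina q b).isEmbedding.injective.eq_iff,
    eq_comm]

end CameraType

/-- The global configuration space: the motions of `n` points, the individual parameters of `m`
cameras, and the parameters shared by all cameras. -/
abbrev Configuration (d k n m : ℕ) (M B : Type*) : Type _ :=
  (Fin n → PointMotion d k) × (Fin m → M) × B

/-- The manifold structure of the configuration space, for a camera parameter manifold of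
dimension `f` and a manifold of global parameters of dimension `h`. -/
abbrev configurationModel (d k n m f h : ℕ) :=
  𝓘(ℝ, Fin n → PointMotion d k).prod
    ((ModelWithCorners.pi fun _ : Fin m => 𝓡 f).prod (𝓡 h))

/-- The structure from motion map for moving points: the entry `(i, j)` is the picture
`Q_j (P_i (t_j))` of the `i`-th point, taken by the `j`-th camera at time `t j`. -/
def sfmMap {d k n m : ℕ} {M B S : Type*} [TopologicalSpace S]
    [ChartedSpace (EuclideanSpace ℝ (Fin (d - 1))) S] (C : CameraType d M B S)
    (t : Fin m → ℝ) (x : Configuration d k n m M B) : Fin n → Fin m → S :=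
  fun i j => C.picture (x.2.1 j) x.2.2 (position (x.1 i) (t j))

/-- The configuration `x` is locally determined, up to the symmetry group `G`, by its image data
`F x`. -/
def LocallyReconstructible (G : Type*) {X Y : Type*} [TopologicalSpace X] [Group G]
    [MulAction G X] (F : X → Y) (x : X) : Prop :=
  ∃ U ∈ nhds x, ∀ y ∈ U, F y = F x → y ∈ MulAction.orbit G x

/-- A subset of a manifold is null if it has Lebesgue measure zero in the charts. The normalization
of the Lebesgue (Haar) measure on the model vector space is irrelevant. -/
def IsNull {E H X : Type*} [NormedAddCommGroup E] [NormedSpace ℝ E] [FiniteDimensional ℝ E]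
    [TopologicalSpace H] (I : ModelWithCorners ℝ E H) [TopologicalSpace X] [ChartedSpace H X]
    (A : Set X) : Prop :=
  letI : MeasurableSpace E := borel E
  haveI : BorelSpace E := ⟨rfl⟩
  ∀ x : X, (MeasureTheory.Measure.addHaar : MeasureTheory.Measure E)
    (extChartAt I x '' ((extChartAt I x).source ∩ A)) = 0

end StructureFromMotion

end

/-!
In a chart the configuration space is an open subset of a vector space `E` of dimension
`D = d n (k + 1) + m f + h`, and, once charts of `S` are chosen, the structure from motion map is a
real analytic map `F : E → Y` with `dim Y = n m (d - 1)`. Two dimension counts are compared.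

*Fibres are large.* On a ball, the rank of the derivative of `F` is maximal off the zero set of a
minor, and this zero set is null because the minor is a nonzero analytic function
(`measure_zeroSet_eq_zero_of_analyticOnNhd`, `exists_ae_ker_fderiv_eq`). Analyticity is essential
here: for a smooth map the rank may fail to be locally constant on a set of positive measure. Where
the rank is locally constant, the inverse function theorem straightens a maximal set of independent
components of `F`, and the fibre through the point contains, in every neighbourhood of the point, a
graph over an open subset of the kernel of the derivative (`finrank_le_add_dimH_fibre`). Hence, for
almost every point, the part of its fibre in any of its neighbourhoods has Hausdorff dimension at
least `D - dim Y`.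

*Orbits are small.* The orbit of a point is the image of a second countable manifold of dimension
`g` under a `C^1` map, so its Hausdorff dimension in a chart is at most `g`
(`dimH_extChartAt_image_orbit_le`).

At a locally reconstructible point the local fibre lies in the orbit. So, if `D > dim Y + g`, almost
no point is locally reconstructible (`isNull_locallyReconstructible`).
-/

namespace StructureFromMotion

open MeasureTheory Set Filter Topology Module

/-! ### Finite products of manifolds -/

instance boundaryless_modelWithCorners_pi {ι : Type*} [Fintype ι] {E H : ι → Type*}
    [∀ i, NormedAddCommGroup (E i)] [∀ i, NormedSpace ℝ (E i)] [∀ i, TopologicalSpace (H i)]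
    (I : ∀ i, ModelWithCorners ℝ (E i) (H i)) [∀ i, (I i).Boundaryless] :
    (ModelWithCorners.pi I).Boundaryless where
  range_eq_univ := by
    change range (Pi.map fun i => I i) = univ
    rw [range_piMap]
    simp [ModelWithCorners.range_eq_univ]

instance isManifold_pi {ι : Type*} [Fintype ι] {E H : ι → Type*}
    [∀ i, NormedAddCommGroup (E i)] [∀ i, NormedSpace ℝ (E i)] [∀ i, TopologicalSpace (H i)]
    (I : ∀ i, ModelWithCorners ℝ (E i) (H i)) (n : ℕ∞ω) (M : ι → Type*)
    [∀ i, TopologicalSpace (M i)] [∀ i, ChartedSpace (H i) (M i)] [∀ i, IsManifold (I i) n (M i)] :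
    IsManifold (ModelWithCorners.pi I) n (∀ i, M i) := by
  apply isManifold_of_contDiffOn
  rintro _ _ ⟨e, he, rfl⟩ ⟨e', he', rfl⟩
  rw [contDiffOn_pi]
  intro i
  have hi := (contDiffGroupoid n (I i)).compatible (he i (mem_univ i)) (he' i (mem_univ i))
  rw [contDiffGroupoid, mem_groupoid_of_pregroupoid] at hi
  refine ContDiffOn.comp (g := I i ∘ ((e i).symm ≫ₕ e' i) ∘ (I i).symm) hi.1
    (f := fun x : ∀ i, E i => x i)
    (ContinuousLinearMap.proj (R := ℝ) (φ := E) i).contDiff.contDiffOn ?_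
  rintro x ⟨hx, y, rfl⟩
  refine ⟨?_, mem_range_self (y i)⟩
  obtain ⟨hx1, hx2⟩ := hx
  exact ⟨hx1 i (mem_univ i), hx2 i (mem_univ i)⟩

/-! ### Zero sets of analytic functions -/

section Analytic

variable {E : Type*} [NormedAddCommGroup E] [NormedSpace ℝ E] [FiniteDimensional ℝ E]
  [MeasurableSpace E] [BorelSpace E]

/-- Auxiliary case of `measure_zeroSet_eq_zero_of_analyticOnNhd`: the point where the function does
not vanish is the origin, so that polar coordinates apply. -/
theorem measure_zeroSet_eq_zero_of_zero_mem (μ : Measure E) [μ.IsAddHaarMeasure]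
    {f : E → ℝ} {U : Set E} (hU : IsOpen U) (hc : Convex ℝ U) (hf : AnalyticOnNhd ℝ f U)
    (h0 : (0 : E) ∈ U) (hne : f 0 ≠ 0) : μ {x ∈ U | f x = 0} = 0 := by
  set Z : Set E := {x ∈ U | f x = 0} with hZ
  have hZm : MeasurableSet Z := by
    have : Z = U \ (U ∩ f ⁻¹' {0}ᶜ) := by
      ext x; simp [hZ]
    rw [this]
    exact hU.measurableSet.diff
      (hf.continuousOn.isOpen_inter_preimage hU isOpen_compl_singleton).measurableSet
  have hZ0 : Z ⊆ {0}ᶜ := by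
    rintro x ⟨-, hx⟩ rfl
    exact hne hx
  have hmp := μ.measurePreserving_homeomorphUnitSphereProd
  -- In polar coordinates the zero set becomes a set whose radial sections are discrete.
  set Z' : Set (Metric.sphere (0 : E) 1 × Ioi (0 : ℝ)) :=
    (homeomorphUnitSphereProd E).symm ⁻¹' (Subtype.val ⁻¹' Z) with hZ'
  have hZ'm : MeasurableSet Z' :=
    (homeomorphUnitSphereProd E).symm.measurable (measurable_subtype_coe hZm)
  have hpre : homeomorphUnitSphereProd E ⁻¹' Z' = Subtype.val ⁻¹' Z := by
    ext x; simp [hZ']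
  have key : (μ.toSphere.prod (Measure.volumeIoiPow (finrank ℝ E - 1))) Z' = 0 := by
    rw [Measure.measure_prod_null hZ'm]
    refine Eventually.of_forall fun v => ?_
    change Measure.volumeIoiPow (finrank ℝ E - 1) _ = 0
    have hac : Measure.volumeIoiPow (finrank ℝ E - 1) ≪
        (Measure.comap Subtype.val (volume : Measure ℝ)) := by
      rw [Measure.volumeIoiPow]
      exact withDensity_absolutelyContinuous _ _
    apply hac
    rw [comap_subtype_coe_apply measurableSet_Ioi]
    -- The line through the origin in the direction of `v`.
    set ℓ : ℝ → E := fun r => r • (v : E) with hℓ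
    have hℓa : AnalyticOnNhd ℝ ℓ univ := fun r _ => by
      exact analyticAt_id.smul analyticAt_const
    have hℓc : Continuous ℓ := by fun_prop
    have hV : IsOpen (ℓ ⁻¹' U) := hU.preimage hℓc
    have hVc : IsPreconnected (ℓ ⁻¹' U) := by
      have : Convex ℝ (ℓ ⁻¹' U) :=
        hc.linear_preimage ((LinearMap.id : ℝ →ₗ[ℝ] ℝ).smulRight (v : E))
      exact this.isPreconnected
    have hg : AnalyticOnNhd ℝ (f ∘ ℓ) (ℓ ⁻¹' U) :=
      hf.comp (hℓa.mono (subset_univ _)) (fun r hr => hr)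
    have h0V : (0 : ℝ) ∈ ℓ ⁻¹' U := by simpa [hℓ] using h0
    have hcod := hg.preimage_zero_mem_codiscreteWithin (x := 0) (by simpa [hℓ] using hne) h0V
      ⟨⟨0, h0V⟩, hVc⟩
    have hae := ae_restrict_le_codiscreteWithin (μ := (volume : Measure ℝ)) hV.measurableSet hcod
    rw [mem_ae_iff, Measure.restrict_apply' hV.measurableSet] at hae
    refine measure_mono_null ?_ hae
    rintro _ ⟨r, hr, rfl⟩
    have : (r : ℝ) • (v : E) ∈ Z := by simpa [hZ'] using hr
    exact ⟨fun h => h this.2, this.1⟩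
  rw [← hmp.measure_preimage hZ'm.nullMeasurableSet, hpre,
    comap_subtype_coe_apply (measurableSet_singleton 0).compl] at key
  rwa [Subtype.image_preimage_coe, inter_eq_self_of_subset_right hZ0] at key

/-- A real analytic function on a convex open set that is not identically zero vanishes only on a
set of measure zero: on every line through a point where it does not vanish, its zeros are
isolated. -/
theorem measure_zeroSet_eq_zero_of_analyticOnNhd (μ : Measure E) [μ.IsAddHaarMeasure]
    {f : E → ℝ} {U : Set E} (hU : IsOpen U) (hc : Convex ℝ U) (hf : AnalyticOnNhd ℝ f U)
    {a : E} (ha : a ∈ U) (hne : f a ≠ 0) : μ {x ∈ U | f x = 0} = 0 := by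
  have h := measure_zeroSet_eq_zero_of_zero_mem μ (f := fun x => f (a + x))
    (U := (fun x => a + x) ⁻¹' U) (hU.preimage (by fun_prop)) (hc.translate_preimage_right a)
    (fun x hx => (hf _ hx).comp (analyticAt_const.add analyticAt_id)) (by simpa using ha)
    (by simpa using hne)
  rw [← measure_preimage_add μ a]
  exact h

end Analytic

/-! ### Generic rank -/

section Rank

variable {E Y : Type*} [NormedAddCommGroup E] [NormedSpace ℝ E] [FiniteDimensional ℝ E]
  [NormedAddCommGroup Y] [NormedSpace ℝ Y] [FiniteDimensional ℝ Y]

theorem analyticOnNhd_det {E V : Type*} [NormedAddCommGroup E] [NormedSpace ℝ E]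
    [NormedAddCommGroup V] [NormedSpace ℝ V]
    [FiniteDimensional ℝ V] {A : E → V →L[ℝ] V} {U : Set E} (hA : AnalyticOnNhd ℝ A U) :
    AnalyticOnNhd ℝ (fun x => LinearMap.det (A x : V →ₗ[ℝ] V)) U := by
  let b := Module.finBasis ℝ V
  have hentry : ∀ i j, AnalyticOnNhd ℝ
      (fun x => LinearMap.toMatrix b b (A x : V →ₗ[ℝ] V) i j) U := by
    intro i j
    have : (fun x => LinearMap.toMatrix b b (A x : V →ₗ[ℝ] V) i j) =
        fun x => (((b.coord i).toContinuousLinearMap).comp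
          (ContinuousLinearMap.apply ℝ V (b j))) (A x) := by
      ext x
      simp [LinearMap.toMatrix_apply]
    rw [this]
    exact fun x hx => (ContinuousLinearMap.analyticAt _ _).comp (hA x hx)
  have : (fun x => LinearMap.det (A x : V →ₗ[ℝ] V)) = fun x =>
      ∑ σ : Equiv.Perm (Fin (finrank ℝ V)), ((Equiv.Perm.sign σ : ℤ) : ℝ) *
        ∏ i, LinearMap.toMatrix b b (A x : V →ₗ[ℝ] V) (σ i) i := by
    ext x
    rw [← LinearMap.det_toMatrix b, Matrix.det_apply']
  rw [this]
  exact Finset.analyticOnNhd_fun_sum _ fun σ _ => analyticOnNhd_const.mul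
    (Finset.analyticOnNhd_fun_prod _ fun i _ => hentry _ _)

/-- At almost every point of a convex open set, the rank of the derivative of an analytic map `F`
is maximal, hence locally constant. This is expressed by a linear map `π` for which `π ∘ F` is a
submersion near the point, while its derivative has the same kernel as that of `F`. -/
theorem exists_ae_ker_fderiv_eq [MeasurableSpace E] [BorelSpace E] (μ : Measure E)
    [μ.IsAddHaarMeasure] {F : E → Y} {U : Set E} (hU : IsOpen U) (hc : Convex ℝ U)
    (hF : AnalyticOnNhd ℝ F U) :
    ∃ (V : Submodule ℝ Y) (π : Y →L[ℝ] V), ∀ᵐ x ∂μ, x ∈ U →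
      Function.Surjective (π ∘L fderiv ℝ F x) ∧
      ∀ᶠ y in 𝓝 x, ∀ w, π (fderiv ℝ F y w) = 0 → fderiv ℝ F y w = 0 := by
  rcases U.eq_empty_or_nonempty with rfl | hne
  · exact ⟨⊤, 0, by simp⟩
  -- A point `a` where the rank is maximal.
  obtain ⟨a, haU, hmax⟩ : ∃ a ∈ U, ∀ y ∈ U,
      finrank ℝ (fderiv ℝ F y).range ≤ finrank ℝ (fderiv ℝ F a).range := by
    have hfin : ((fun y => finrank ℝ (fderiv ℝ F y).range) '' U).Finite :=
      (finite_Iic (finrank ℝ Y)).subset (by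
        rintro _ ⟨y, -, rfl⟩
        exact Submodule.finrank_le _)
    obtain ⟨a, ha, h⟩ := exists_max_image _ id hfin (hne.image _)
    obtain ⟨a, haU, rfl⟩ := ha
    exact ⟨a, haU, fun y hy => h _ ⟨y, hy, rfl⟩⟩
  set V : Submodule ℝ Y := (fderiv ℝ F a).range with hV
  obtain ⟨q, hq⟩ := Submodule.exists_isCompl V
  set π : Y →L[ℝ] V := (V.projectionOnto q hq).toContinuousLinearMap with hπ
  obtain ⟨s, hs⟩ := (fderiv ℝ F a).toLinearMap.rangeRestrict.exists_rightInverse_of_surjective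
    (LinearMap.range_rangeRestrict _)
  set B : V →L[ℝ] E := s.toContinuousLinearMap with hB
  -- The determinant of `A` is a maximal minor of the derivative.
  set A : E → V →L[ℝ] V := fun x => π ∘L fderiv ℝ F x ∘L B with hA
  have hAan : AnalyticOnNhd ℝ A U := by
    have : A = fun x => (ContinuousLinearMap.compL ℝ V Y V π)
        ((ContinuousLinearMap.compL ℝ V E Y).flip B (fderiv ℝ F x)) := rfl
    rw [this]
    exact fun x hx => (ContinuousLinearMap.analyticAt _ _).comp
      ((ContinuousLinearMap.analyticAt _ _).comp (hF.fderiv x hx))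
  have hdet := analyticOnNhd_det hAan
  have hAa : (A a : V →ₗ[ℝ] V) = LinearMap.id := by
    ext1 v
    have h1 : fderiv ℝ F a (B v) = v := congrArg Subtype.val (LinearMap.congr_fun hs v)
    change π (fderiv ℝ F a (B v)) = v
    rw [h1]
    exact Submodule.projectionOnto_apply_left hq v
  have hnull := measure_zeroSet_eq_zero_of_analyticOnNhd μ hU hc hdet haU (by simp [hAa])
  have hsurj : ∀ y, LinearMap.det (A y : V →ₗ[ℝ] V) ≠ 0 →
      Function.Surjective (π ∘L fderiv ℝ F y) := by
    intro y hy v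
    obtain ⟨w, hw⟩ := (LinearEquiv.ofIsUnitDet (f := (A y : V →ₗ[ℝ] V))
      (v := Module.finBasis ℝ V) (v' := Module.finBasis ℝ V)
      (by simpa [LinearMap.det_toMatrix] using hy)).surjective v
    exact ⟨B w, hw⟩
  refine ⟨V, π, ?_⟩
  filter_upwards [measure_eq_zero_iff_ae_notMem.1 hnull] with x hx hxU
  have hx0 : LinearMap.det (A x : V →ₗ[ℝ] V) ≠ 0 := fun h => hx ⟨hxU, h⟩
  refine ⟨hsurj x hx0, ?_⟩
  filter_upwards [(hdet x hxU).continuousAt.eventually_ne hx0, hU.mem_nhds hxU] with y hy hyU w hw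
  -- `π` maps the range of the derivative onto `V`, whose dimension is at least as large.
  set T := (π : Y →ₗ[ℝ] V).domRestrict (fderiv ℝ F y).range with hT
  have hTs : Function.Surjective T := by
    intro v
    obtain ⟨u, hu⟩ := hsurj y hy v
    exact ⟨⟨fderiv ℝ F y u, u, rfl⟩, hu⟩
  have hTr : finrank ℝ (fderiv ℝ F y).range = finrank ℝ V :=
    le_antisymm (hmax y hyU) (LinearMap.finrank_le_finrank_of_surjective hTs)
  have hTi : Function.Injective T :=
    (LinearMap.injective_iff_surjective_of_finrank_eq_finrank hTr).2 hTs
  have h0 : (⟨fderiv ℝ F y w, w, rfl⟩ : (fderiv ℝ F y).range) = 0 :=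
    hTi (by rw [map_zero]; exact hw)
  exact congrArg Subtype.val h0

end Rank

/-! ### Dimension of fibres -/

section Fibre

variable {E Y V : Type*} [NormedAddCommGroup E] [NormedSpace ℝ E] [FiniteDimensional ℝ E]
  [NormedAddCommGroup Y] [NormedSpace ℝ Y] [NormedAddCommGroup V] [NormedSpace ℝ V]
  [FiniteDimensional ℝ V]

/-- Where the rank of the derivative is constant, the fibres of a differentiable map have at least
the expected dimension. -/
theorem finrank_le_add_dimH_fibre {F : E → Y} {x : E} (hF : ContDiffAt ℝ 1 F x) (π : Y →L[ℝ] V)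
    (hsurj : Function.Surjective (π ∘L fderiv ℝ F x))
    (hker : ∀ᶠ y in 𝓝 x, ∀ w, π (fderiv ℝ F y w) = 0 → fderiv ℝ F y w = 0)
    {U : Set E} (hU : U ∈ 𝓝 x) :
    (finrank ℝ E : ENNReal) ≤ finrank ℝ V + dimH (U ∩ F ⁻¹' {F x}) := by
  set L : E →L[ℝ] V := π ∘L fderiv ℝ F x with hL
  obtain ⟨q, hq⟩ := Submodule.exists_isCompl L.ker
  set K : E →L[ℝ] L.ker := (L.ker.projectionOnto q hq).toContinuousLinearMap with hK
  have hKrange : K.range = ⊤ := Submodule.range_projectionOnto hq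
  have hKker : K.ker = q := Submodule.ker_projectionOnto hq
  set A : E ≃L[ℝ] V × L.ker := ContinuousLinearMap.equivProdOfSurjectiveOfIsCompl L K
    (LinearMap.range_eq_top.2 hsurj) hKrange (hKker ▸ hq) with hA
  -- Adapted coordinates: `π ∘ F`, completed by linear coordinates on the kernel.
  set Ψ : E → V × L.ker := fun y => (π (F y), K y) with hΨ
  have hΨc : ContDiffAt ℝ 1 Ψ x := (π.contDiff.contDiffAt.comp x hF).prodMk K.contDiff.contDiffAt
  have hΨd : HasFDerivAt Ψ (A : E →L[ℝ] V × L.ker) x := by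
    have h1 := (π.hasFDerivAt.comp x (hF.differentiableAt one_ne_zero).hasFDerivAt).prodMk
      (K.hasFDerivAt (x := x))
    exact h1
  set e := hΨc.toOpenPartialHomeomorph Ψ hΨd one_ne_zero with he
  have hxe : x ∈ e.source := hΨc.mem_toOpenPartialHomeomorph_source hΨd one_ne_zero
  have hex : e x = Ψ x := rfl
  have hsymm : ContDiffAt ℝ 1 e.symm (Ψ x) := hΨc.to_localInverse hΨd one_ne_zero
  have hsx : e.symm (Ψ x) = x := e.left_inv hxe
  -- The slice of the fibre of `π ∘ F` through `x`.
  set c : L.ker → E := fun v => e.symm (π (F x), v) with hc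
  have hcx : c (K x) = x := hsx
  have hι : ContinuousAt (fun v : L.ker => (π (F x), v)) (K x) := by fun_prop
  have hcc : ContinuousAt c (K x) :=
    ContinuousAt.comp (g := e.symm) (f := fun v : L.ker => (π (F x), v)) hsymm.continuousAt hι
  have hgood : ∀ᶠ v in 𝓝 (K x), c v ∈ U ∧ ContDiffAt ℝ 1 F (c v) ∧
      (∀ w, π (fderiv ℝ F (c v) w) = 0 → fderiv ℝ F (c v) w = 0) ∧
      ContDiffAt ℝ 1 e.symm (π (F x), v) ∧ (π (F x), v) ∈ e.target := by
    have hcc' : Tendsto c (𝓝 (K x)) (𝓝 x) := by simpa [ContinuousAt, hcx] using hcc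
    refine (hcc'.eventually hU).and ((hcc'.eventually (hF.eventually (by simp))).and
      ((hcc'.eventually hker).and ?_))
    exact (hι.eventually (hsymm.eventually (by simp))).and
      (hι.eventually (e.open_target.mem_nhds (e.map_source hxe)))
  obtain ⟨ε, hε, hball⟩ := Metric.eventually_nhds_iff_ball.1 hgood
  have hright : ∀ v ∈ Metric.ball (K x) ε, π (F (c v)) = π (F x) ∧ K (c v) = v := by
    intro v hv
    have := e.right_inv (hball v hv).2.2.2.2
    exact Prod.ext_iff.1 this
  have hcd : ∀ v ∈ Metric.ball (K x) ε, DifferentiableAt ℝ c v := by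
    intro v hv
    exact DifferentiableAt.comp (g := e.symm) v
      ((hball v hv).2.2.2.1.differentiableAt one_ne_zero) (by fun_prop)
  have hFd : ∀ v ∈ Metric.ball (K x) ε, DifferentiableAt ℝ F (c v) := fun v hv =>
    (hball v hv).2.1.differentiableAt one_ne_zero
  -- `π ∘ F` is constant on the slice, so by the kernel condition `F` is constant there as well.
  have hconst : ∀ v ∈ Metric.ball (K x) ε, F (c v) = F x := by
    intro v hv
    have := Metric.isOpen_ball.is_const_of_fderiv_eq_zero (𝕜 := ℝ) (f := F ∘ c)
      (convex_ball (K x) ε).isPreconnected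
      (fun v hv => ((hFd v hv).comp v (hcd v hv)).differentiableWithinAt) ?_ hv
      (Metric.mem_ball_self hε)
    · simpa [hcx] using this
    intro u hu
    have h0 : HasFDerivAt (fun v => π (F (c v))) (0 : L.ker →L[ℝ] V) u := by
      refine (hasFDerivAt_const (π (F x)) u).congr_of_eventuallyEq ?_
      filter_upwards [Metric.isOpen_ball.mem_nhds hu] with v hv using (hright v hv).1
    have h1 : HasFDerivAt (F ∘ c) (fderiv ℝ F (c u) ∘L fderiv ℝ c u) u :=
      (hFd u hu).hasFDerivAt.comp u (hcd u hu).hasFDerivAt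
    have h2 := h0.unique (π.hasFDerivAt.comp u h1)
    rw [h1.fderiv]
    ext w
    exact (hball u hu).2.2.1 _ (DFunLike.congr_fun h2 w).symm
  have hsub : Metric.ball (K x) ε ⊆ K '' (U ∩ F ⁻¹' {F x}) := fun v hv =>
    ⟨c v, ⟨(hball v hv).1, hconst v hv⟩, (hright v hv).2⟩
  have hdim : (finrank ℝ L.ker : ENNReal) ≤ dimH (U ∩ F ⁻¹' {F x}) := by
    rw [← Real.dimH_of_mem_nhds (Metric.ball_mem_nhds (K x) hε)]
    exact (dimH_mono hsub).trans (K.lipschitz.dimH_image_le _)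
  have hfin : finrank ℝ E = finrank ℝ V + finrank ℝ L.ker := by
    rw [A.toLinearEquiv.finrank_eq, finrank_prod]
  rw [hfin, Nat.cast_add]
  gcongr

end Fibre

/-- Almost every point of a convex open set is a point at which the germ of the fibre of an
analytic map `F : E → Y` has dimension at least `dim E - dim Y`. -/
theorem ae_finrank_le_add_dimH_fibre {E Y : Type*} [NormedAddCommGroup E] [NormedSpace ℝ E]
    [FiniteDimensional ℝ E] [MeasurableSpace E] [BorelSpace E] [NormedAddCommGroup Y]
    [NormedSpace ℝ Y] [FiniteDimensional ℝ Y] (μ : Measure E) [μ.IsAddHaarMeasure] {F : E → Y}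
    {U : Set E} (hU : IsOpen U) (hc : Convex ℝ U) (hF : AnalyticOnNhd ℝ F U) :
    ∀ᵐ x ∂μ, x ∈ U → ∀ N ∈ 𝓝 x,
      (finrank ℝ E : ENNReal) ≤ finrank ℝ Y + dimH (N ∩ F ⁻¹' {F x}) := by
  obtain ⟨V, π, h⟩ := exists_ae_ker_fderiv_eq μ hU hc hF
  filter_upwards [h] with x hx hxU N hN
  refine (finrank_le_add_dimH_fibre (hF x hxU).contDiffAt π (hx hxU).1 (hx hxU).2 hN).trans ?_
  gcongr
  exact V.finrank_le

/-! ### Dimension of orbits -/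

section Orbit

variable {E' H' G : Type*} [NormedAddCommGroup E'] [NormedSpace ℝ E'] [FiniteDimensional ℝ E']
  [TopologicalSpace H'] {J : ModelWithCorners ℝ E' H'} [J.Boundaryless]
  [TopologicalSpace G] [ChartedSpace H' G]
  {E : Type*} [NormedAddCommGroup E] [NormedSpace ℝ E]

/-- A `C^1` map does not raise the dimension of a manifold, locally at a point. -/
theorem exists_mem_nhds_dimH_image_le {h : G → E} {γ : G} (hh : ContMDiffAt J 𝓘(ℝ, E) 1 h γ) :
    ∃ N ∈ 𝓝 γ, dimH (h '' N) ≤ finrank ℝ E' := by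
  have h1 := (contMDiffAt_iff.1 hh).2
  rw [J.range_eq_univ, contDiffWithinAt_univ] at h1
  simp only [extChartAt_model_space_eq_id, PartialEquiv.refl_coe, Function.id_comp] at h1
  obtain ⟨ε, hε, hball⟩ := Metric.eventually_nhds_iff_ball.1 (h1.eventually (by simp))
  refine ⟨(extChartAt J γ).source ∩ extChartAt J γ ⁻¹' Metric.ball (extChartAt J γ γ) ε,
    inter_mem (extChartAt_source_mem_nhds γ)
      ((continuousAt_extChartAt γ).preimage_mem_nhds (Metric.ball_mem_nhds _ hε)), ?_⟩
  have hsub : h '' ((extChartAt J γ).source ∩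
      extChartAt J γ ⁻¹' Metric.ball (extChartAt J γ γ) ε) ⊆
      (h ∘ (extChartAt J γ).symm) '' Metric.ball (extChartAt J γ γ) ε := by
    rintro _ ⟨δ, ⟨hδ, hδ'⟩, rfl⟩
    exact ⟨extChartAt J γ δ, hδ', congrArg h ((extChartAt J γ).left_inv hδ)⟩
  refine (dimH_mono hsub).trans ?_
  rw [← Real.dimH_of_mem_nhds (Metric.ball_mem_nhds (extChartAt J γ γ) hε)]
  exact ContDiffOn.dimH_image_le (fun y hy => (hball y hy).contDiffWithinAt) (convex_ball _ _)
    Subset.rfl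

/-- Second countability of `G` reduces the bound to countably many charts. -/
theorem dimH_image_le_finrank [SecondCountableTopology G] {h : G → E} {O : Set G}
    (hh : ∀ γ ∈ O, ContMDiffAt J 𝓘(ℝ, E) 1 h γ) : dimH (h '' O) ≤ finrank ℝ E' := by
  choose! N hN hdim using fun γ (hγ : γ ∈ O) => exists_mem_nhds_dimH_image_le (hh γ hγ)
  obtain ⟨t, htO, htc, hcov⟩ := TopologicalSpace.countable_cover_nhdsWithin
    (f := N) fun γ hγ => mem_nhdsWithin_of_mem_nhds (hN γ hγ)
  calc dimH (h '' O) ≤ dimH (⋃ γ ∈ t, h '' N γ) := by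
        refine dimH_mono ?_
        rw [← image_iUnion₂]
        exact image_mono hcov
    _ ≤ finrank ℝ E' := by
        rw [dimH_bUnion htc]
        exact iSup₂_le fun γ hγ => hdim γ (htO hγ)

variable (J) in
/-- In a chart, the orbits of a Lie group have at most the dimension of the group. -/
theorem dimH_extChartAt_image_orbit_le
    {H X : Type*} [TopologicalSpace H] (I : ModelWithCorners ℝ E H)
    [TopologicalSpace X] [ChartedSpace H X] [IsManifold I 1 X]
    [Group G] [SecondCountableTopology G] [MulAction G X] [ContMDiffSMul J I 1 G X] (x₀ x : X) :
    dimH (extChartAt I x₀ '' ((extChartAt I x₀).source ∩ MulAction.orbit G x)) ≤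
      finrank ℝ E' := by
  have himage : extChartAt I x₀ '' ((extChartAt I x₀).source ∩ MulAction.orbit G x) ⊆
      (fun γ : G => extChartAt I x₀ (γ • x)) '' {γ | γ • x ∈ (extChartAt I x₀).source} := by
    rintro _ ⟨_, ⟨hy, γ, rfl⟩, rfl⟩
    exact ⟨γ, hy, rfl⟩
  refine (dimH_mono himage).trans (dimH_image_le_finrank (J := J) fun γ hγ => ?_)
  have h1 : ContMDiff J I 1 (fun γ : G => γ • x) :=
    (contMDiff_smul (I := J) (I' := I) (n := 1) (G := G) (M := X)).comp
      (contMDiff_id.prodMk contMDiff_const)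
  have hγ' : γ • x ∈ (chartAt H x₀).source := by simpa using hγ
  exact (contMDiffAt_extChartAt' hγ').comp γ (h1 γ)

end Orbit

/-! ### Local reconstruction -/

/-- If the fibres of finitely many analytic functions on a manifold, seen as one map `F`, have
larger expected dimension than the group, then almost no point is locally reconstructible. -/
theorem isNull_locallyReconstructible {E E' E'' H H' H'' X S G ι : Type*} [Fintype ι]
    [NormedAddCommGroup E] [NormedSpace ℝ E] [FiniteDimensional ℝ E]
    [NormedAddCommGroup E'] [NormedSpace ℝ E'] [FiniteDimensional ℝ E']
    [NormedAddCommGroup E''] [NormedSpace ℝ E''] [FiniteDimensional ℝ E'']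
    [TopologicalSpace H] [TopologicalSpace H'] [TopologicalSpace H'']
    (I : ModelWithCorners ℝ E H) [I.Boundaryless] (J : ModelWithCorners ℝ E' H') [J.Boundaryless]
    (K : ModelWithCorners ℝ E'' H'')
    [TopologicalSpace X] [ChartedSpace H X] [IsManifold I ω X]
    [TopologicalSpace S] [ChartedSpace H'' S] [IsManifold K ω S]
    [TopologicalSpace G] [ChartedSpace H' G] [SecondCountableTopology G]
    [Group G] [MulAction G X] [ContMDiffSMul J I 1 G X]
    {W : Set X} (hW : IsOpen W) {F : X → ι → S}
    (hF : ∀ i, ContMDiffOn I K ω (fun x => F x i) W)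
    (hdim : Fintype.card ι * finrank ℝ E'' + finrank ℝ E' < finrank ℝ E) :
    IsNull I {x | x ∈ W ∧ LocallyReconstructible G F x} := by
  have : IsManifold I 1 X := IsManifold.of_le (n := ω) le_top
  intro x₀
  borelize E
  set φ := extChartAt I x₀ with hφ
  have hφo : IsOpen φ.target := isOpen_extChartAt_target x₀
  have hφc : ContinuousOn φ.symm φ.target := continuousOn_extChartAt_symm x₀
  change (Measure.addHaar : Measure E) _ = 0
  refine measure_null_of_locally_null _ ?_
  rintro _ ⟨x, ⟨hxs, hxW, -⟩, rfl⟩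
  set O : Set E := φ.target ∩ φ.symm ⁻¹' W with hO
  have hOo : IsOpen O := hφc.isOpen_inter_preimage hφo hW
  have hxO : φ x ∈ O := ⟨φ.map_source hxs, by simpa [φ.left_inv hxs] using hxW⟩
  have hFO : ∀ i, ContMDiffOn 𝓘(ℝ, E) K ω (fun y => F (φ.symm y) i) O := fun i =>
    (hF i).comp ((contMDiffOn_extChartAt_symm x₀).mono inter_subset_left) fun y hy => hy.2
  -- A ball on which the images stay in charts of `S`.
  have hchart : ∀ᶠ y in 𝓝 (φ x), y ∈ O ∧ ∀ i, F (φ.symm y) i ∈ (extChartAt K (F x i)).source := by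
    refine Eventually.and (hOo.mem_nhds hxO) (eventually_all.2 fun i => ?_)
    have hcont := (hFO i).continuousOn.continuousAt (hOo.mem_nhds hxO)
    refine hcont.eventually ?_
    simp only [φ.left_inv hxs]
    exact extChartAt_source_mem_nhds (F x i)
  obtain ⟨ε, hε, hball⟩ := Metric.eventually_nhds_iff_ball.1 hchart
  set U := Metric.ball (φ x) ε with hU
  set Φ : E → ι → E'' := fun y i => extChartAt K (F x i) (F (φ.symm y) i) with hΦ
  have hΦan : AnalyticOnNhd ℝ Φ U := by
    have : ContDiffOn ℝ ω Φ U := by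
      rw [contDiffOn_pi]
      intro i
      rw [← contMDiffOn_iff_contDiffOn]
      refine (contMDiffOn_extChartAt (x := F x i)).comp ((hFO i).mono fun y hy => (hball y hy).1) ?_
      intro y hy
      simpa using (hball y hy).2 i
    rw [← Metric.isOpen_ball.analyticOn_iff_analyticOnNhd]
    exact this.analyticOn
  have hae := ae_finrank_le_add_dimH_fibre (Measure.addHaar : Measure E) Metric.isOpen_ball
    (convex_ball (φ x) ε) hΦan
  refine ⟨U ∩ φ '' (φ.source ∩ {x | x ∈ W ∧ LocallyReconstructible G F x}),
    inter_mem (mem_nhdsWithin_of_mem_nhds (Metric.ball_mem_nhds _ hε)) self_mem_nhdsWithin, ?_⟩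
  refine measure_mono_null ?_ (mem_ae_iff.1 hae)
  rintro _ ⟨hyU, y, ⟨hys, hyW, R, hR, hrec⟩, rfl⟩ hgood
  have hN : U ∩ φ.symm ⁻¹' R ∈ 𝓝 (φ y) := by
    refine inter_mem (Metric.isOpen_ball.mem_nhds hyU) ?_
    refine (hφc.continuousAt (hφo.mem_nhds (φ.map_source hys))).preimage_mem_nhds ?_
    rwa [φ.left_inv hys]
  have hsub : U ∩ φ.symm ⁻¹' R ∩ Φ ⁻¹' {Φ (φ y)} ⊆ φ '' (φ.source ∩ MulAction.orbit G y) := by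
    rintro z ⟨⟨hzU, hzR⟩, hz⟩
    have hzt : z ∈ φ.target := (hball z hzU).1.1
    refine ⟨φ.symm z, ⟨φ.map_target hzt, hrec _ hzR ?_⟩, φ.right_inv hzt⟩
    funext i
    have hi := congrFun hz i
    have := (extChartAt K (F x i)).injOn ((hball z hzU).2 i) ((hball _ hyU).2 i) hi
    simpa [φ.left_inv hys] using this
  have h1 := hgood hyU _ hN
  have h2 := (dimH_mono hsub).trans (dimH_extChartAt_image_orbit_le J I x₀ y)
  have h3 : (finrank ℝ E : ENNReal) ≤ finrank ℝ (ι → E'') + finrank ℝ E' :=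
    h1.trans (by gcongr)
  have h4 : finrank ℝ (ι → E'') = Fintype.card ι * finrank ℝ E'' := by
    simp [finrank_pi_fintype]
  rw [h4] at h3
  exact absurd (by exact_mod_cast h3) (not_le.2 hdim)

end StructureFromMotion

theorem mainTheorem2 {d k n m f h g : ℕ} (hd : 1 ≤ d)
    -- the manifold of individual camera parameters
    {M : Type*} [TopologicalSpace M] [ChartedSpace (EuclideanSpace ℝ (Fin f)) M]
    [IsManifold (𝓡 f) ω M]
    -- the manifold of global camera parameters
    {B : Type*} [TopologicalSpace B] [ChartedSpace (EuclideanSpace ℝ (Fin h)) B]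
    [IsManifold (𝓡 h) ω B]
    -- the retinal surface
    {S : Type*} [TopologicalSpace S] [ChartedSpace (EuclideanSpace ℝ (Fin (d - 1))) S]
    [IsManifold (𝓡 (d - 1)) ω S]
    -- the cameras and the times of the pictures
    (C : StructureFromMotion.CameraType d M B S) (t : Fin m → ℝ)
    -- the structure from motion map is real analytic on an open set
    (W : Set (StructureFromMotion.Configuration d k n m M B)) (hW : IsOpen W)
    (hF : ∀ i j, ContMDiffOn (StructureFromMotion.configurationModel d k n m f h) (𝓡 (d - 1)) ω
      (fun x => StructureFromMotion.sfmMap C t x i j) W)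
    -- the symmetry group: a Lie group of dimension `g` that does not change the pictures
    {G : Type*} [Group G] [TopologicalSpace G] [ChartedSpace (EuclideanSpace ℝ (Fin g)) G]
    [LieGroup (𝓡 g) ∞ G] [SecondCountableTopology G]
    [MulAction G (StructureFromMotion.Configuration d k n m M B)]
    [ContMDiffSMul (𝓡 g) (StructureFromMotion.configurationModel d k n m f h) ∞ G
      (StructureFromMotion.Configuration d k n m M B)]
    (hG : ∀ (γ : G) (x : StructureFromMotion.Configuration d k n m M B), x ∈ W → γ • x ∈ W →
      StructureFromMotion.sfmMap C t (γ • x) = StructureFromMotion.sfmMap C t x)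
    -- reconstruction is possible with positive probability
    (hrec : ¬ StructureFromMotion.IsNull (StructureFromMotion.configurationModel d k n m f h)
      {x | x ∈ W ∧
        StructureFromMotion.LocallyReconstructible G (StructureFromMotion.sfmMap C t) x}) :
    d * n * (k + 1) + m * f + h ≤ n * m * (d - 1) + g := by
  by_contra hlt
  rw [not_le] at hlt
  have hnull := StructureFromMotion.isNull_locallyReconstructible (G := G) (ι := Fin n × Fin m)
    (StructureFromMotion.configurationModel d k n m f h) (𝓡 g) (𝓡 (d - 1)) hW
    (F := fun x ij => StructureFromMotion.sfmMap C t x ij.1 ij.2) (fun ij => hF ij.1 ij.2) ?_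
  · refine hrec ?_
    convert hnull using 6 with x
    -- Equality of image data means equality of all entries, for curried and for paired indices.
    simp [StructureFromMotion.LocallyReconstructible, funext_iff]
  · simp [Module.finrank_pi_fintype]
    linarith
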